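/- Let $n\ge 1$ and let $\nu_1,\dots,\nu_n$ be fixed nonnegative integers, and put $\alpha_n=\nu_1+\cdots+\nu_n$. For a positive integer $N$ let $\omega_{n,N}$ be the weight $$\omega_{n,N}(z)=\int_{\mathbb C^n}\prod_{j=1}^n\frac{|x_j|^{2\nu_j}}{(1+|x_j|^2)^{\nu_j+N+1}}\;\delta\Big(z-\prod_{j=1}^n x_j\Big)\,d^2x_1\cdots d^2x_n ,$$ where $d^2x$ is Lebesgue measure on $\mathbb C$ and the Dirac mass is evaluated by integrating out $x_n$, that is, for $z\neq0$, $$\omega_{n,N}(z)=\int_{\mathbb C^{n-1}}\Big(\prod_{j=1}^{n-1}\frac{|x_j|^{2\nu_j}}{(1+|x_j|^2)^{\nu_j+N+1}}\Big)\frac{|x_n|^{2\nu_n}}{(1+|x_n|^2)^{\nu_n+N+1}}\Big|_{x_n=z/(x_1\cdots x_{n-1})}\frac{d^2x_1\cdots d^2x_{n-1}}{|x_1\cdots x_{n-1}|^2}.$$ Then for every fixed $z\in\mathbb C\setminus\{0\}$, as $N\to\infty$, $$\omega_{n,N}(z)\sim\frac{(2\pi)^{\frac32(n-1)}}{2^{n-1}N^{\frac{n-1}2}\sqrt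 n}\;\frac{|z|^{\frac{1-n+2\alpha_n}{n}}}{\big(1+|z|^{\frac2n}\big)^{nN+\alpha_n+1}},$$ i.e. the quotient of the two sides tends to $1$. -/

import Mathlib

open MeasureTheory

/-- The one-matrix weight `|x|^(2ν) / (1 + |x|²)^(ν + N + 1)` on the complex plane. -/
noncomputable def factorWeight (ν N : ℕ) (x : ℂ) : ℝ :=
  ‖x‖ ^ (2 * ν) / (1 + ‖x‖ ^ 2) ^ (ν + N + 1)

/-- The integrand left after the Dirac mass in
`∫_{ℂⁿ} ∏ⱼ wⱼ(xⱼ) δ(z - ∏ⱼ xⱼ) d²x₁ ⋯ d²xₙ` (here `n = m + 1`) has been used to integrate out the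
last variable: `xₙ = z / (x₁ ⋯ xₙ₋₁)`, with real Jacobian `|x₁ ⋯ xₙ₋₁|⁻²`. -/
noncomputable def weightIntegrand {m : ℕ} (ν : Fin (m + 1) → ℕ) (N : ℕ) (z : ℂ)
    (y : Fin m → ℂ) : ℝ :=
  (∏ j, factorWeight (ν j.castSucc) N (y j)) *
    factorWeight (ν (Fin.last m)) N (z / ∏ j, y j) * (‖∏ j, y j‖ ^ 2)⁻¹

/-- The weight
`ω_{n,N}(z) = ∫_{ℂⁿ} ∏ⱼ |xⱼ|^(2νⱼ) / (1 + |xⱼ|²)^(νⱼ + N + 1) δ(z - ∏ⱼ xⱼ) d²x₁ ⋯ d²xₙ`, `n = m + 1`,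
where `d²x` is Lebesgue measure on `ℂ`. See `map_prod_eq_withDensity_productWeight`. -/
noncomputable def productWeight {m : ℕ} (ν : Fin (m + 1) → ℕ) (N : ℕ) (z : ℂ) : ℝ :=
  ∫ y : Fin m → ℂ, weightIntegrand ν N z y

/-- The leading-order expression
`(2π)^(3(n-1)/2) / (2^(n-1) N^((n-1)/2) √n) * |z|^((1-n+2α)/n) / (1 + |z|^(2/n))^(nN+α+1)`. -/
noncomputable def saddlePointWeight (n α N : ℕ) (z : ℂ) : ℝ :=
  (2 * Real.pi) ^ (3 / 2 * ((n : ℝ) - 1)) /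
      ((2 : ℝ) ^ ((n : ℝ) - 1) * (N : ℝ) ^ (((n : ℝ) - 1) / 2) * √(n : ℝ)) *
    (‖z‖ ^ ((1 - (n : ℝ) + 2 * (α : ℝ)) / (n : ℝ)) /
      (1 + ‖z‖ ^ (2 / (n : ℝ))) ^ (n * N + α + 1))

theorem factorWeight_nonneg (ν N : ℕ) (x : ℂ) : 0 ≤ factorWeight ν N x := by
  unfold factorWeight; positivity

theorem measurable_factorWeight (ν N : ℕ) : Measurable (factorWeight ν N) := by
  unfold factorWeight; fun_prop

theorem weightIntegrand_nonneg {m : ℕ} (ν : Fin (m + 1) → ℕ) (N : ℕ) (z : ℂ) (y : Fin m → ℂ) :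
    0 ≤ weightIntegrand ν N z y :=
  mul_nonneg (mul_nonneg (Finset.prod_nonneg fun _ _ => factorWeight_nonneg _ _ _)
    (factorWeight_nonneg _ _ _)) (by positivity)

theorem measurable_weightIntegrand {m : ℕ} (ν : Fin (m + 1) → ℕ) (N : ℕ) :
    Measurable fun p : ℂ × (Fin m → ℂ) => weightIntegrand ν N p.1 p.2 := by
  unfold weightIntegrand
  refine Measurable.mul (Measurable.mul ?_ ?_) (by fun_prop)
  · exact Finset.measurable_prod _ fun j _ => (measurable_factorWeight _ _).comp (by fun_prop)
  · exact (measurable_factorWeight _ _).comp (by fun_prop)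

theorem measurable_weightIntegrand_right {m : ℕ} (ν : Fin (m + 1) → ℕ) (N : ℕ) (z : ℂ) :
    Measurable (weightIntegrand (m := m) ν N z) :=
  Measurable.of_uncurry_left (f := weightIntegrand ν N) (measurable_weightIntegrand ν N)

theorem integrable_factorWeight (ν N : ℕ) (hN : 1 ≤ N) : Integrable (factorWeight ν N) := by
  have h := integrable_rpow_neg_one_add_norm_sq (E := ℂ) (μ := volume) (r := 4)
    (by rw [Complex.finrank_real_complex]; norm_num)
  refine h.mono' (measurable_factorWeight ν N).aestronglyMeasurable (.of_forall fun x => ?_)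
  rw [Real.norm_of_nonneg (factorWeight_nonneg _ _ _)]
  have h1 : (1 : ℝ) ≤ 1 + ‖x‖ ^ 2 := by nlinarith [sq_nonneg ‖x‖]
  have h2 : ((1 : ℝ) + ‖x‖ ^ 2) ^ (-(4 : ℝ) / 2) = 1 / (1 + ‖x‖ ^ 2) ^ 2 := by
    rw [show (-(4 : ℝ) / 2) = -((2 : ℕ) : ℝ) by norm_num, Real.rpow_neg (by positivity),
      Real.rpow_natCast, one_div]
  rw [h2, factorWeight, div_le_div_iff₀ (by positivity) (by positivity), one_mul, pow_mul]
  calc (‖x‖ ^ 2) ^ ν * (1 + ‖x‖ ^ 2) ^ 2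
      ≤ (1 + ‖x‖ ^ 2) ^ ν * (1 + ‖x‖ ^ 2) ^ (N + 1) := by
        gcongr
        · linarith
        · omega
    _ = (1 + ‖x‖ ^ 2) ^ (ν + N + 1) := by rw [← pow_add, add_assoc]

theorem lintegral_comp_complex_mul (p : ℂ) (hp : p ≠ 0) (g : ℂ → ENNReal) (hg : Measurable g) :
    ∫⁻ c, g c = ∫⁻ z, g (z / p) * ENNReal.ofReal (‖p‖ ^ 2)⁻¹ := by
  have hd : LinearMap.det (Algebra.lmul ℝ ℂ p) = ‖p‖ ^ 2 := by
    rw [← Algebra.norm_apply, Algebra.norm_complex_apply, Complex.normSq_eq_norm_sq]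
  have hm := Measure.map_linearMap_addHaar_eq_smul_addHaar (volume : Measure ℂ)
    (f := Algebra.lmul ℝ ℂ p) (by rw [hd]; positivity)
  rw [hd, abs_of_nonneg (by positivity)] at hm
  have hmeas : Measurable (fun c : ℂ => p * c) := by fun_prop
  have hm' : Measure.map (fun c : ℂ => p * c) volume
      = ENNReal.ofReal (‖p‖ ^ 2)⁻¹ • (volume : Measure ℂ) := hm
  have hg' : Measurable fun z => g (z / p) := hg.comp (by fun_prop)
  calc ∫⁻ c, g c = ∫⁻ c, g (p * c / p) := by simp [hp]
    _ = ∫⁻ z, g (z / p) ∂(Measure.map (fun c : ℂ => p * c) volume) := by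
        rw [lintegral_map hg' hmeas]
    _ = _ := by rw [hm', lintegral_smul_measure, lintegral_mul_const _ hg', smul_eq_mul, mul_comm]

theorem lintegral_prod_eq_lintegral_weightIntegrand {m : ℕ} (ν : Fin (m + 1) → ℕ) (N : ℕ)
    (f : ℂ → ENNReal) (hf : Measurable f) :
    ∫⁻ x : Fin (m + 1) → ℂ, f (∏ j, x j) * ENNReal.ofReal (∏ j, factorWeight (ν j) N (x j)) =
      ∫⁻ z, f z * ∫⁻ y : Fin m → ℂ, ENNReal.ofReal (weightIntegrand ν N z y) := by
  have hF : Measurable fun x : Fin (m + 1) → ℂ =>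
      f (∏ j, x j) * ENNReal.ofReal (∏ j, factorWeight (ν j) N (x j)) := by
    refine (hf.comp (by fun_prop)).mul (Measurable.ennreal_ofReal ?_)
    exact Finset.measurable_prod _ fun j _ => (measurable_factorWeight _ _).comp (by fun_prop)
  have hK := (measurable_weightIntegrand ν N).ennreal_ofReal
  rw [← ((volume_preserving_piFinSuccAbove (fun _ => ℂ) (Fin.last m)).symm).lintegral_comp hF]
  have hF' := hF.comp (MeasurableEquiv.piFinSuccAbove (fun _ => ℂ) (Fin.last m)).symm.measurable
  rw [Measure.volume_eq_prod]
  refine (lintegral_prod_symm _ hF'.aemeasurable).trans ?_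
  have hae : ∀ᵐ y : Fin m → ℂ, ∏ j, y j ≠ 0 := by
    have : ∀ j, ∀ᵐ y : Fin m → ℂ, y j ≠ 0 := fun j => Measure.ae_eval_ne (fun _ => volume) j 0
    filter_upwards [ae_all_iff.2 this] with y hy
    exact Finset.prod_ne_zero_iff.2 fun j _ => hy j
  have hstep : ∀ᵐ y : Fin m → ℂ,
      (∫⁻ c, (fun x : Fin (m + 1) → ℂ =>
        f (∏ j, x j) * ENNReal.ofReal (∏ j, factorWeight (ν j) N (x j)))
          ((MeasurableEquiv.piFinSuccAbove (fun _ => ℂ) (Fin.last m)).symm (c, y))) =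
      ∫⁻ z, f z * ENNReal.ofReal (weightIntegrand ν N z y) := by
    filter_upwards [hae] with y hy
    have hmeas : Measurable fun c : ℂ => f ((∏ j, y j) * c) * ENNReal.ofReal
        ((∏ j, factorWeight (ν j.castSucc) N (y j)) * factorWeight (ν (Fin.last m)) N c) :=
      (hf.comp (by fun_prop)).mul
        (((measurable_factorWeight _ _).const_mul _).ennreal_ofReal)
    have h1 := lintegral_comp_complex_mul (∏ j, y j) hy _ hmeas
    refine Eq.trans (lintegral_congr fun c => ?_) (h1.trans (lintegral_congr fun z => ?_))
    · simp [Fin.prod_univ_castSucc, Fin.insertNthEquiv, MeasurableEquiv.piFinSuccAbove]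
    · rw [mul_div_cancel₀ _ hy, mul_assoc, ← ENNReal.ofReal_mul, weightIntegrand]
      exact mul_nonneg (Finset.prod_nonneg fun _ _ => factorWeight_nonneg _ _ _)
        (factorWeight_nonneg _ _ _)
  refine (lintegral_congr_ae hstep).trans ?_
  rw [lintegral_lintegral_swap]
  · refine lintegral_congr fun z => ?_
    exact lintegral_const_mul _ (measurable_weightIntegrand_right ν N z).ennreal_ofReal
  · have h2 : Measurable fun p : (Fin m → ℂ) × ℂ =>
        ENNReal.ofReal (weightIntegrand ν N p.2 p.1) := by
      have h := hK.comp (measurable_swap (α := Fin m → ℂ) (β := ℂ))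
      simpa only [Function.comp_def, Prod.fst_swap, Prod.snd_swap] using h
    have h3 : Measurable fun p : (Fin m → ℂ) × ℂ => f p.2 := hf.comp measurable_snd
    exact (h3.mul h2).aemeasurable

/-- The defining property of the Dirac mass: `productWeight` is the Lebesgue density of the image
of the measure `∏ⱼ wⱼ(xⱼ) d²x₁ ⋯ d²xₙ` under `(x₁, …, xₙ) ↦ x₁ ⋯ xₙ`. -/
theorem map_prod_eq_withDensity_productWeight {m : ℕ} (ν : Fin (m + 1) → ℕ) (N : ℕ)
    (hN : 1 ≤ N) :
    Measure.map (fun x : Fin (m + 1) → ℂ => ∏ j, x j)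
        (volume.withDensity fun x => ENNReal.ofReal (∏ j, factorWeight (ν j) N (x j))) =
      (volume : Measure ℂ).withDensity fun z => ENNReal.ofReal (productWeight ν N z) := by
  have hK := (measurable_weightIntegrand ν N).ennreal_ofReal
  have hP : Measurable fun x : Fin (m + 1) → ℂ => ∏ j, x j := by fun_prop
  have hfin : ∫⁻ z, ∫⁻ y : Fin m → ℂ, ENNReal.ofReal (weightIntegrand ν N z y) ≠ ⊤ := by
    have h := lintegral_prod_eq_lintegral_weightIntegrand ν N (fun _ => 1) measurable_const
    simp only [one_mul] at h
    rw [← h]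
    exact (Integrable.fintype_prod (f := fun j => factorWeight (ν j) N)
      fun j => integrable_factorWeight (ν j) N hN).lintegral_lt_top.ne
  have hae : ∀ᵐ z : ℂ, ENNReal.ofReal (productWeight ν N z) =
      ∫⁻ y : Fin m → ℂ, ENNReal.ofReal (weightIntegrand ν N z y) := by
    have hmI : Measurable fun z : ℂ =>
        ∫⁻ y : Fin m → ℂ, ENNReal.ofReal (weightIntegrand ν N z y) := hK.lintegral_prod_right'
    filter_upwards [ae_lt_top hmI hfin] with z hz
    have h0 : ∀ᵐ y : Fin m → ℂ, 0 ≤ weightIntegrand ν N z y :=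
      ae_of_all _ (weightIntegrand_nonneg ν N z)
    have hi : Integrable (weightIntegrand ν N z) (volume : Measure (Fin m → ℂ)) :=
      ⟨(measurable_weightIntegrand_right ν N z).aestronglyMeasurable,
        (hasFiniteIntegral_iff_ofReal h0).2 hz⟩
    unfold productWeight
    exact ofReal_integral_eq_lintegral_ofReal hi h0
  ext s hs
  have h := lintegral_prod_eq_lintegral_weightIntegrand ν N (s.indicator 1)
    (measurable_one.indicator hs)
  rw [Measure.map_apply hP hs, withDensity_apply _ (hP hs), withDensity_apply _ hs,
    ← lintegral_indicator (hP hs), ← lintegral_indicator hs]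
  refine Eq.trans (lintegral_congr fun x => ?_) (h.trans (lintegral_congr_ae ?_))
  · by_cases hx : ∏ j, x j ∈ s <;> simp [Set.indicator, hx]
  · filter_upwards [hae] with z hz
    by_cases hx : z ∈ s <;> simp [Set.indicator, hx, hz]

open Filter Topology

/-! This is Laplace's method, made exact up to the last limit. The integrand depends on moduli only,
and in the coordinate `t = log ‖x‖` the measure `d²x / ‖x‖²` is `dt dθ`. Hence the weight is
`(2π)^(n-1)` times an integral over the hyperplane `∑ tⱼ = log ‖z‖`
(`productWeight_eq_integral_exp`).

The part of a factor that varies with `N` is `(1 + e^(2t))^(-N)`. By convexity of `log (1 + e^(2t))`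
the product peaks on the hyperplane at `tⱼ = a = log ‖z‖ / n`. With `t = a + v`, `p = e^(2a) / (1 +
e^(2a))` and `q = 1 - p`, one has `(1 + e^(2t)) / (1 + e^(2a)) = q + p e^(2v) = e^(2pv) M(v)`, where
`M` is `saddleProfile p q`. The exponentials `e^(-2pNv)` multiply to `1`, since the deviations `v`
sum to zero.

At `v = u / √N` the power `M^N` tends to `e^(2pq u²)`, and Bernoulli's inequality supplies an
integrable bound free of `N` (`tendsto_integral_prod_rescaledFactor`). The limit is a Gaussian
integral with form `∑ uⱼ² + (∑ uⱼ)²`, whose determinant `n` produces the factor `√n`. -/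

/-! ### Logarithmic polar coordinates. -/

theorem lintegral_Ioi_comp_log (g : ℝ → ENNReal) :
    ∫⁻ r in Set.Ioi (0 : ℝ), ENNReal.ofReal r⁻¹ * g (Real.log r) = ∫⁻ t, g t := by
  have h := lintegral_image_eq_lintegral_abs_deriv_mul (s := Set.univ) MeasurableSet.univ
    (fun t _ => (Real.hasDerivAt_exp t).hasDerivWithinAt) Real.exp_injective.injOn
    (fun r => ENNReal.ofReal r⁻¹ * g (Real.log r))
  rw [Set.image_univ, Real.range_exp, setLIntegral_univ] at h
  rw [h]
  refine lintegral_congr fun t => ?_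
  rw [abs_of_pos (Real.exp_pos t), ← mul_assoc, ← ENNReal.ofReal_mul (Real.exp_pos t).le,
    mul_inv_cancel₀ (Real.exp_pos t).ne', Real.log_exp, ENNReal.ofReal_one, one_mul]

/-- The polar area element `r dr dθ` divided by `r²` is `dθ dr / r = dθ dt`; the angle contributes
`2π`. -/
theorem lintegral_comp_log_norm (g : ℝ → ENNReal) (hg : Measurable g) :
    ∫⁻ c : ℂ, g (Real.log ‖c‖) * ENNReal.ofReal (‖c‖ ^ 2)⁻¹ =
      ENNReal.ofReal (2 * Real.pi) * ∫⁻ t, g t := by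
  rw [← Complex.lintegral_comp_polarCoord_symm, polarCoord_target, Measure.volume_eq_prod,
    ← Measure.prod_restrict]
  have h : ∀ᵐ p : ℝ × ℝ ∂((volume.restrict (Set.Ioi (0 : ℝ))).prod
      (volume.restrict (Set.Ioo (-Real.pi) Real.pi))),
      ENNReal.ofReal p.1 • (g (Real.log ‖Complex.polarCoord.symm p‖) *
        ENNReal.ofReal (‖Complex.polarCoord.symm p‖ ^ 2)⁻¹) =
      (ENNReal.ofReal p.1⁻¹ * g (Real.log p.1)) * 1 := by
    rw [Measure.prod_restrict]
    filter_upwards [ae_restrict_mem (measurableSet_Ioi.prod measurableSet_Ioo)] with p hp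
    have hp' : 0 < p.1 := hp.1
    rw [Complex.norm_polarCoord_symm, abs_of_pos hp', smul_eq_mul, mul_left_comm,
      ← ENNReal.ofReal_mul hp'.le, mul_one, mul_comm]
    congr 2
    field_simp
  rw [lintegral_congr_ae h, lintegral_prod_mul (f := fun r => ENNReal.ofReal r⁻¹ * g (Real.log r))
    (g := fun _ => 1) (by fun_prop) (by fun_prop), lintegral_Ioi_comp_log, lintegral_one,
    Measure.restrict_apply_univ, Real.volume_Ioo, mul_comm]
  congr 2
  ring

/-- Tonelli peels off one coordinate per induction step. Working with `∫⁻` avoids any integrability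
condition. -/
theorem lintegral_pi_comp_log_norm (m : ℕ) (F : (Fin m → ℝ) → ENNReal) (hF : Measurable F) :
    ∫⁻ y : Fin m → ℂ, F (fun j => Real.log ‖y j‖) * ∏ j, ENNReal.ofReal (‖y j‖ ^ 2)⁻¹ =
      ENNReal.ofReal (2 * Real.pi) ^ m * ∫⁻ t, F t := by
  induction m with
  | zero =>
    simp [volume_pi, lintegral_unique]
    congr 1
    exact Subsingleton.elim _ _
  | succ m ih =>
    have hG : Measurable fun y : Fin (m + 1) → ℂ =>
        F (fun j => Real.log ‖y j‖) * ∏ j, ENNReal.ofReal (‖y j‖ ^ 2)⁻¹ := by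
      refine (hF.comp (by fun_prop)).mul (Finset.measurable_prod _ fun j _ => by fun_prop)
    have hcons : Measurable fun p : ℝ × (Fin m → ℝ) =>
        F (Fin.cons (α := fun _ => ℝ) p.1 p.2) := by
      refine hF.comp (measurable_pi_lambda _ fun j => ?_)
      refine Fin.cases ?_ (fun i => ?_) j
      · simpa using measurable_fst
      · simp only [Fin.cons_succ]; fun_prop
    have hI : Measurable fun c : ℝ => ∫⁻ t, F (Fin.cons (α := fun _ => ℝ) c t) :=
      hcons.lintegral_prod_right'
    rw [← ((volume_preserving_piFinSuccAbove (fun _ => ℂ) 0).symm).lintegral_comp hG,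
      ← ((volume_preserving_piFinSuccAbove (fun _ => ℝ) 0).symm).lintegral_comp hF,
      Measure.volume_eq_prod, Measure.volume_eq_prod]
    have l1 := lintegral_prod (μ := (volume : Measure ℂ)) (ν := (volume : Measure (Fin m → ℂ))) _
      (hG.comp (MeasurableEquiv.piFinSuccAbove (fun _ => ℂ) 0).symm.measurable).aemeasurable
    have l2 := lintegral_prod (μ := (volume : Measure ℝ)) (ν := (volume : Measure (Fin m → ℝ))) _
      (hF.comp (MeasurableEquiv.piFinSuccAbove (fun _ => ℝ) 0).symm.measurable).aemeasurable
    dsimp only [Function.comp_def] at l1 l2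
    rw [l1, l2]
    have e1 : ∀ t : ℝ, ∀ u : Fin m → ℝ,
        (MeasurableEquiv.piFinSuccAbove (fun _ => ℝ) 0).symm (t, u) =
          Fin.cons (α := fun _ => ℝ) t u := fun t u => by
      simp [MeasurableEquiv.piFinSuccAbove, Fin.insertNthEquiv]
    have e2 : ∀ c : ℂ, ∀ y : Fin m → ℂ,
        (MeasurableEquiv.piFinSuccAbove (fun _ => ℂ) 0).symm (c, y) =
          Fin.cons (α := fun _ => ℂ) c y := fun c y => by
      simp [MeasurableEquiv.piFinSuccAbove, Fin.insertNthEquiv]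
    have e3 : ∀ c : ℂ, ∀ y : Fin m → ℂ,
        (fun j => Real.log ‖(Fin.cons (α := fun _ => ℂ) c y : Fin (m + 1) → ℂ) j‖) =
          Fin.cons (α := fun _ => ℝ) (Real.log ‖c‖) (fun j => Real.log ‖y j‖) := fun c y => by
      funext j
      refine Fin.cases ?_ (fun i => ?_) j <;> simp
    simp only [e1, e2, e3, Fin.prod_univ_succ, Fin.cons_zero, Fin.cons_succ]
    have hc : ∀ c : ℂ, (∫⁻ y : Fin m → ℂ,
        F (Fin.cons (α := fun _ => ℝ) (Real.log ‖c‖) fun j => Real.log ‖y j‖) *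
          (ENNReal.ofReal (‖c‖ ^ 2)⁻¹ * ∏ j, ENNReal.ofReal (‖y j‖ ^ 2)⁻¹)) =
        ENNReal.ofReal (2 * Real.pi) ^ m *
          ((∫⁻ t, F (Fin.cons (α := fun _ => ℝ) (Real.log ‖c‖) t)) *
            ENNReal.ofReal (‖c‖ ^ 2)⁻¹) := fun c => by
      rw [← mul_assoc, ← ih (fun t => F (Fin.cons (α := fun _ => ℝ) (Real.log ‖c‖) t))
        (hcons.comp measurable_prodMk_left), ← lintegral_mul_const]
      · refine lintegral_congr fun y => ?_
        ring
      · refine (hcons.comp (f := fun y : Fin m → ℂ => (Real.log ‖c‖, fun j => Real.log ‖y j‖))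
          (by fun_prop)).mul (Finset.measurable_prod _ fun j _ => by fun_prop)
    simp only [hc]
    rw [lintegral_const_mul, lintegral_comp_log_norm _ hI, ← mul_assoc, pow_succ]
    exact (hI.comp (by fun_prop)).mul (by fun_prop)

theorem integral_pi_comp_log_norm (m : ℕ) (F : (Fin m → ℝ) → ℝ) (hF : Measurable F)
    (hF0 : ∀ t, 0 ≤ F t) :
    ∫ y : Fin m → ℂ, F (fun j => Real.log ‖y j‖) * ∏ j, (‖y j‖ ^ 2)⁻¹ =
      (2 * Real.pi) ^ m * ∫ t, F t := by
  have h := lintegral_pi_comp_log_norm m (fun t => ENNReal.ofReal (F t)) hF.ennreal_ofReal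
  rw [integral_eq_lintegral_of_nonneg_ae (ae_of_all _ fun y => mul_nonneg (hF0 _) (by positivity)),
    integral_eq_lintegral_of_nonneg_ae (ae_of_all _ hF0) hF.aestronglyMeasurable]
  · have e : ∀ y : Fin m → ℂ,
        ENNReal.ofReal (F (fun j => Real.log ‖y j‖) * ∏ j, (‖y j‖ ^ 2)⁻¹) =
        ENNReal.ofReal (F (fun j => Real.log ‖y j‖)) * ∏ j, ENNReal.ofReal (‖y j‖ ^ 2)⁻¹ :=
      fun y => by
        rw [ENNReal.ofReal_mul (hF0 _), ENNReal.ofReal_prod_of_nonneg fun j _ => by positivity]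
    simp only [e]
    rw [h, ENNReal.toReal_mul, ENNReal.toReal_pow, ENNReal.toReal_ofReal Real.two_pi_pos.le]
  · refine Measurable.aestronglyMeasurable ?_
    exact (hF.comp (by fun_prop)).mul (Finset.measurable_prod _ fun j _ => by fun_prop)

/-- The Jacobian of the eliminated variable is exactly the density that turns Lebesgue measure into
`dt dθ`. Points with some `y j = 0` form a null set. -/
theorem productWeight_eq_integral_exp {m : ℕ} (ν : Fin (m + 1) → ℕ) (N : ℕ) (z : ℂ) (hz : z ≠ 0) :
    productWeight ν N z = (2 * Real.pi) ^ m * ∫ t : Fin m → ℝ,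
      (∏ j, factorWeight (ν j.castSucc) N (Real.exp (t j))) *
        factorWeight (ν (Fin.last m)) N (Real.exp (Real.log ‖z‖ - ∑ j, t j)) := by
  rw [← integral_pi_comp_log_norm m (fun t => (∏ j, factorWeight (ν j.castSucc) N (Real.exp (t j))) *
        factorWeight (ν (Fin.last m)) N (Real.exp (Real.log ‖z‖ - ∑ j, t j)))]
  · refine integral_congr_ae ?_
    have : ∀ j, ∀ᵐ y : Fin m → ℂ, y j ≠ 0 := fun j => Measure.ae_eval_ne (fun _ => volume) j 0
    filter_upwards [ae_all_iff.2 this] with y hy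
    have key : ∀ (k : ℕ) (x : ℂ) (r : ℝ), 0 ≤ r → ‖x‖ = r →
        factorWeight k N x = factorWeight k N (r : ℂ) := fun k x r hr h => by
      simp [factorWeight, h, abs_of_nonneg hr]
    have hn : ∀ j, 0 < ‖y j‖ := fun j => norm_pos_iff.2 (hy j)
    have hlast : ‖z / ∏ j, y j‖ = Real.exp (Real.log ‖z‖ - ∑ j, Real.log ‖y j‖) := by
      rw [Real.exp_sub, Real.exp_log (norm_pos_iff.2 hz), Real.exp_sum, norm_div, norm_prod]
      simp only [Real.exp_log (hn _)]
    simp only [weightIntegrand]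
    rw [key _ _ _ (Real.exp_pos _).le hlast, norm_prod, ← Finset.prod_pow, Finset.prod_inv_distrib]
    congr 2
    refine Finset.prod_congr rfl fun j _ => ?_
    rw [key _ (y j) _ (Real.exp_pos _).le (Real.exp_log (hn j)).symm]
  · refine (Finset.measurable_prod _ fun j _ => (measurable_factorWeight _ _).comp ?_).mul
      ((measurable_factorWeight _ _).comp ?_) <;> fun_prop
  · exact fun t => mul_nonneg (Finset.prod_nonneg fun _ _ => factorWeight_nonneg _ _ _)
      (factorWeight_nonneg _ _ _)

/-! ### The profile at the saddle point: lower bound and scaling limit. -/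

/-- The normalised reciprocal profile `q e^(-2pv) + p e^(2qv)` of a factor around its saddle point,
where `p + q = 1`. -/
noncomputable def saddleProfile (p q v : ℝ) : ℝ :=
  q * Real.exp (-2 * p * v) + p * Real.exp (2 * q * v)

/-- The first-order terms `∓2pqv` cancel. Whichever exponent is nonnegative is expanded to second
order, the other to first; the surviving `2pq²v²` or `2p²qv²` dominates `2(pq)²v²` because `p, q ≤
1`. -/
theorem one_add_sq_le_saddleProfile {p q : ℝ} (hp : 0 ≤ p) (hq : 0 ≤ q) (hpq : p + q = 1) (v : ℝ) :
    1 + 2 * (p * q) ^ 2 * v ^ 2 ≤ saddleProfile p q v := by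
  unfold saddleProfile
  have hp1 : p ≤ 1 := by linarith
  have hq1 : q ≤ 1 := by linarith
  rcases le_total 0 v with hv | hv
  · have h1 := mul_le_mul_of_nonneg_left (Real.add_one_le_exp (-2 * p * v)) hq
    have h2 := mul_le_mul_of_nonneg_left
      (Real.quadratic_le_exp_of_nonneg (show 0 ≤ 2 * q * v by positivity)) hp
    have h3 : p * (p * q ^ 2 * v ^ 2) ≤ 1 * (p * q ^ 2 * v ^ 2) := by gcongr
    nlinarith
  · have h1 := mul_le_mul_of_nonneg_left (Real.add_one_le_exp (2 * q * v)) hp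
    have h2 := mul_le_mul_of_nonneg_left
      (Real.quadratic_le_exp_of_nonneg (show 0 ≤ -2 * p * v by nlinarith)) hq
    have h3 : q * (p ^ 2 * q * v ^ 2) ≤ 1 * (p ^ 2 * q * v ^ 2) := by gcongr
    nlinarith

theorem tendsto_natCast_mul_exp_sub_one_sub_id (x : ℝ) :
    Tendsto (fun N : ℕ => (N : ℝ) * (Real.exp (x * (√N)⁻¹) - 1 - x * (√N)⁻¹)) atTop
      (𝓝 (x ^ 2 / 2)) := by
  have h0 : Tendsto (fun N : ℕ => x * (√(N : ℝ))⁻¹) atTop (𝓝 0) := by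
    have := (Real.tendsto_sqrt_atTop.comp tendsto_natCast_atTop_atTop).inv_tendsto_atTop
      (𝕜 := ℝ) (l := (atTop : Filter ℕ))
    simpa using this.const_mul x
  have hb : ∀ᶠ N : ℕ in atTop,
      ‖(N : ℝ) * (Real.exp (x * (√N)⁻¹) - 1 - x * (√N)⁻¹) - x ^ 2 / 2‖ ≤
        x ^ 2 * |x * (√N)⁻¹| := by
    filter_upwards [h0.abs.eventually (ge_mem_nhds (show |(0 : ℝ)| < 1 by simp)),
      eventually_ge_atTop 1] with N hN hN1
    have hN0 : (0 : ℝ) < N := by exact_mod_cast hN1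
    have hs : (√(N : ℝ)) ^ 2 = N := Real.sq_sqrt hN0.le
    have hs0 : 0 < √(N : ℝ) := Real.sqrt_pos.2 hN0
    set y := x * (√(N : ℝ))⁻¹ with hy
    have hNy : (N : ℝ) * y ^ 2 = x ^ 2 := by
      rw [hy, mul_pow, inv_pow, hs]; field_simp
    -- The cubic Taylor remainder, at most `2/9 * |y|³`, becomes at most `x² |y|` after
    -- multiplication by `N`, since `N y² = x²`.
    have h3 := Real.exp_bound hN (n := 3) (by norm_num)
    simp [Finset.sum_range_succ, Nat.factorial] at h3
    have e : (N : ℝ) * (Real.exp y - 1 - y) - x ^ 2 / 2 =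
        N * (Real.exp y - (1 + y + y ^ 2 / 2)) := by rw [← hNy]; ring
    rw [e, norm_mul, Real.norm_of_nonneg hN0.le, ← hNy, Real.norm_eq_abs, mul_assoc]
    gcongr
    refine h3.trans ?_
    rw [← sq_abs y, pow_succ]
    nlinarith [mul_nonneg (sq_nonneg |y|) (abs_nonneg y)]
  refine tendsto_sub_nhds_zero_iff.1 (squeeze_zero_norm' hb ?_)
  simpa using h0.abs.const_mul (x ^ 2)

/-- `M` is the moment generating function of a centred two-point variable of variance `4pq`, so `N
(M(u/√N) - 1)` tends to `2pq u²`. -/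
theorem tendsto_saddleProfile_pow {p q : ℝ} (hpq : p + q = 1) (u : ℝ) :
    Tendsto (fun N : ℕ => saddleProfile p q ((√N)⁻¹ * u) ^ N) atTop
      (𝓝 (Real.exp (2 * (p * q) * u ^ 2))) := by
  have h := Real.tendsto_one_add_pow_exp_of_tendsto
    (g := fun N : ℕ => saddleProfile p q ((√(N : ℝ))⁻¹ * u) - 1) (t := 2 * (p * q) * u ^ 2) ?_
  · simpa using h
  · have h1 := (tendsto_natCast_mul_exp_sub_one_sub_id (-2 * p * u)).const_mul q
    have h2 := (tendsto_natCast_mul_exp_sub_one_sub_id (2 * q * u)).const_mul p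
    convert h1.add h2 using 1
    · funext N
      simp only [saddleProfile]
      rw [show -2 * p * ((√(N : ℝ))⁻¹ * u) = -2 * p * u * (√(N : ℝ))⁻¹ by ring,
        show 2 * q * ((√(N : ℝ))⁻¹ * u) = 2 * q * u * (√(N : ℝ))⁻¹ by ring]
      linear_combination (N : ℝ) * hpq
    · congr 1
      linear_combination (-(2 * (p * q) * u ^ 2)) * hpq

/-- Bernoulli's inequality applied to the quadratic lower bound: the factor `N` cancels the `1/N` of
the rescaling. -/
theorem saddleProfile_pow_inv_le {p q : ℝ} (hp : 0 ≤ p) (hq : 0 ≤ q) (hpq : p + q = 1) (N : ℕ)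
    (hN : 1 ≤ N) (u : ℝ) :
    (saddleProfile p q ((√N)⁻¹ * u) ^ N)⁻¹ ≤ (1 + 2 * (p * q) ^ 2 * u ^ 2)⁻¹ := by
  have hN0 : (0 : ℝ) < N := by exact_mod_cast hN
  have hs : (√(N : ℝ)) ^ 2 = N := Real.sq_sqrt hN0.le
  refine inv_anti₀ (by positivity) ?_
  have h1 := one_add_sq_le_saddleProfile hp hq hpq ((√N)⁻¹ * u)
  refine le_trans ?_ (pow_le_pow_left₀ (by positivity) h1 N)
  refine le_trans (le_of_eq ?_) (one_add_mul_le_pow (le_trans (by norm_num) (by positivity :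
    (0 : ℝ) ≤ 2 * (p * q) ^ 2 * ((√N)⁻¹ * u) ^ 2)) N)
  rw [mul_pow (√(N : ℝ))⁻¹, inv_pow, hs]
  field_simp

theorem integrable_inv_one_add_mul_sq {k : ℝ} (hk : 0 < k) :
    Integrable fun u : ℝ => (1 + k * u ^ 2)⁻¹ := by
  have h := integrable_inv_one_add_sq.comp_mul_left' (Real.sqrt_pos.2 hk).ne'
  simpa only [mul_pow, Real.sq_sqrt hk.le] using h

/-! ### The limiting Gaussian integral. -/

/-- The form has matrix `I + J`, `J` all ones. Its square root `A = I + κJ` reduces the integral to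
the standard one, at the cost of `det A = √(m + 1)`. -/
theorem integral_exp_neg_sum_sq_add_sq_sum (m : ℕ) (b : ℝ) :
    ∫ u : Fin m → ℝ, Real.exp (-b * (∑ j, u j ^ 2 + (∑ j, u j) ^ 2)) =
      √(Real.pi / b) ^ m / √((m : ℝ) + 1) := by
  set w : ℝ := √((m : ℝ) + 1) with hw
  have hw0 : 0 < w := by positivity
  have hw2 : w ^ 2 = m + 1 := Real.sq_sqrt (by positivity)
  -- The positive root of `2κ + mκ² = 1`, the condition for `(I + κJ)² = I + J`.
  set κ : ℝ := (1 + w)⁻¹ with hκ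
  have hκw : κ * (1 + w) = 1 := inv_mul_cancel₀ (by positivity)
  have hκm : κ * m = w - 1 := by
    have : (m : ℝ) = (w - 1) * (1 + w) := by linarith
    rw [this]; linear_combination (w - 1) * hκw
  let A : Matrix (Fin m) (Fin m) ℝ :=
    (1 : Matrix (Fin m) (Fin m) ℝ) + Matrix.replicateCol Unit (fun _ => κ) * Matrix.replicateRow Unit (fun _ => (1 : ℝ))
  have hdet : A.det = w := by
    rw [Matrix.det_one_add_replicateCol_mul_replicateRow]
    simp [dotProduct]
    linarith
  have happ : ∀ v : Fin m → ℝ, ∀ i, Matrix.toLin' A v i = v i + κ * ∑ j, v j := fun v i => by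
    simp [A, Matrix.toLin'_apply, Matrix.mulVec, dotProduct, Matrix.mul_apply,
      Finset.mul_sum]
  have hmap := Real.map_matrix_volume_pi_eq_smul_volume_pi (M := A) (by rw [hdet]; exact hw0.ne')
  have hsq : ∀ v : Fin m → ℝ, ∑ i, Matrix.toLin' A v i ^ 2 = ∑ j, v j ^ 2 + (∑ j, v j) ^ 2 :=
    fun v => by
      simp only [happ, add_sq, Finset.sum_add_distrib, Finset.sum_const, Finset.card_univ,
        Fintype.card_fin, nsmul_eq_mul]
      rw [← Finset.sum_mul, ← Finset.mul_sum]
      set S := ∑ j, v j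
      have h : 2 * κ + κ ^ 2 * m = 1 := by
        linear_combination κ * hκm + hκw
      linear_combination S ^ 2 * h
  have hG : ∫ u : Fin m → ℝ, Real.exp (-b * ∑ j, u j ^ 2) = √(Real.pi / b) ^ m := by
    simp only [Finset.mul_sum, Real.exp_sum]
    rw [integral_fintype_prod_volume_eq_pow (fun x : ℝ => Real.exp (-b * x ^ 2)),
      integral_gaussian, Fintype.card_fin]
  have hmeas : Measurable (Matrix.toLin' A) := by
    refine measurable_pi_lambda _ fun i => ?_
    simp only [happ]; fun_prop
  calc _ = ∫ u : Fin m → ℝ, Real.exp (-b * ∑ i, Matrix.toLin' A u i ^ 2) := by simp only [hsq]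
    _ = ∫ u, Real.exp (-b * ∑ i, u i ^ 2) ∂(Measure.map (Matrix.toLin' A) volume) := by
        rw [integral_map hmeas.aemeasurable]
        exact Measurable.aestronglyMeasurable (by fun_prop)
    _ = _ := by
        rw [hmap, integral_smul_measure, hG, hdet, abs_of_pos (inv_pos.2 hw0),
          ENNReal.toReal_ofReal (inv_pos.2 hw0).le, smul_eq_mul, ← div_eq_inv_mul]

/-! ### Rescaled factors and dominated convergence. -/

/-- The part of a factor of the weight that does not vary with `N`, normalised to be `1` at the
saddle point. -/
noncomputable def saddleAmplitude (p q : ℝ) (ν : ℕ) (v : ℝ) : ℝ :=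
  Real.exp (2 * v) ^ ν / (q + p * Real.exp (2 * v)) ^ (ν + 1)

/-- A normalised factor of the weight, rescaled by `1 / √N` around the saddle point. -/
noncomputable def rescaledFactor (p q : ℝ) (ν N : ℕ) (u : ℝ) : ℝ :=
  saddleAmplitude p q ν ((√N)⁻¹ * u) * (saddleProfile p q ((√N)⁻¹ * u) ^ N)⁻¹

theorem saddleProfile_pos {p q : ℝ} (hp : 0 < p) (hq : 0 < q) (v : ℝ) :
    0 < saddleProfile p q v := by
  unfold saddleProfile; positivity

theorem add_mul_exp_eq_exp_mul_saddleProfile {p q : ℝ} (hpq : p + q = 1) (v : ℝ) :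
    q + p * Real.exp (2 * v) = Real.exp (2 * p * v) * saddleProfile p q v := by
  have h1 : Real.exp (2 * p * v) * Real.exp (-2 * p * v) = 1 := by
    rw [← Real.exp_add, ← Real.exp_zero]; congr 1; ring
  have h2 : Real.exp (2 * p * v) * Real.exp (2 * q * v) = Real.exp (2 * v) := by
    rw [← Real.exp_add]; congr 1; linear_combination 2 * v * hpq
  rw [saddleProfile]
  linear_combination -q * h1 - p * h2

theorem saddleAmplitude_nonneg {p q : ℝ} (hp : 0 < p) (hq : 0 < q) (ν : ℕ) (v : ℝ) :
    0 ≤ saddleAmplitude p q ν v := by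
  unfold saddleAmplitude; positivity

/-- Of the `ν + 1` denominators, `ν` are bounded below by `p e^(2v)` and one by `q`. -/
theorem saddleAmplitude_le {p q : ℝ} (hp : 0 < p) (hq : 0 < q) (ν : ℕ) (v : ℝ) :
    saddleAmplitude p q ν v ≤ (p ^ ν * q)⁻¹ := by
  unfold saddleAmplitude
  have he := Real.exp_pos (2 * v)
  rw [inv_eq_one_div, div_le_div_iff₀ (by positivity) (by positivity), one_mul, ← mul_assoc,
    ← mul_pow, pow_succ, mul_comm _ p]
  gcongr
  · linarith
  · nlinarith

theorem rescaledFactor_nonneg {p q : ℝ} (hp : 0 < p) (hq : 0 < q) (ν N : ℕ) (u : ℝ) :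
    0 ≤ rescaledFactor p q ν N u :=
  mul_nonneg (saddleAmplitude_nonneg hp hq _ _)
    (inv_nonneg.2 (pow_nonneg (saddleProfile_pos hp hq _).le _))

theorem rescaledFactor_le {p q : ℝ} (hp : 0 < p) (hq : 0 < q) (hpq : p + q = 1) (ν N : ℕ)
    (hN : 1 ≤ N) (u : ℝ) :
    rescaledFactor p q ν N u ≤ (p ^ ν * q)⁻¹ * (1 + 2 * (p * q) ^ 2 * u ^ 2)⁻¹ :=
  mul_le_mul (saddleAmplitude_le hp hq _ _) (saddleProfile_pow_inv_le hp.le hq.le hpq N hN u)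
    (inv_nonneg.2 (pow_nonneg (saddleProfile_pos hp hq _).le _)) (by positivity)

theorem continuous_rescaledFactor {p q : ℝ} (hp : 0 < p) (hq : 0 < q) (ν N : ℕ) :
    Continuous (rescaledFactor p q ν N) := by
  unfold rescaledFactor saddleAmplitude
  refine Continuous.mul (Continuous.div (by fun_prop) (by fun_prop) fun u => by positivity)
    (Continuous.inv₀ (by unfold saddleProfile; fun_prop)
      fun u => (pow_pos (saddleProfile_pos hp hq _) _).ne')

theorem tendsto_rescaledFactor {p q : ℝ} (hp : 0 < p) (hq : 0 < q) (hpq : p + q = 1) (ν : ℕ)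
    (u : ℝ) :
    Tendsto (fun N : ℕ => rescaledFactor p q ν N u) atTop
      (𝓝 (Real.exp (-(2 * (p * q)) * u ^ 2))) := by
  have h0 : Tendsto (fun N : ℕ => (√(N : ℝ))⁻¹ * u) atTop (𝓝 0) := by
    have h : Tendsto (fun N : ℕ => (√(N : ℝ))⁻¹) atTop (𝓝 0) :=
      (Real.tendsto_sqrt_atTop.comp tendsto_natCast_atTop_atTop).inv_tendsto_atTop
    simpa using h.mul_const u
  have hc : Continuous (saddleAmplitude p q ν) := by
    unfold saddleAmplitude
    exact Continuous.div (by fun_prop) (by fun_prop) fun u => by positivity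
  have h1 := (hc.tendsto 0).comp h0
  have e : saddleAmplitude p q ν 0 = 1 := by
    simp [saddleAmplitude, add_comm q p, hpq]
  rw [e] at h1
  have h2 := h1.mul ((tendsto_saddleProfile_pow hpq u).inv₀ (Real.exp_pos _).ne')
  rw [one_mul, ← Real.exp_neg, ← neg_mul] at h2
  exact h2

theorem tendsto_integral_prod_rescaledFactor {p q : ℝ} (hp : 0 < p) (hq : 0 < q)
    (hpq : p + q = 1) {m : ℕ} (ν : Fin (m + 1) → ℕ) :
    Tendsto (fun N : ℕ => ∫ u : Fin m → ℝ, (∏ j, rescaledFactor p q (ν j.castSucc) N (u j)) *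
        rescaledFactor p q (ν (Fin.last m)) N (-∑ j, u j)) atTop
      (𝓝 (√(Real.pi / (2 * (p * q))) ^ m / √((m : ℝ) + 1))) := by
  rw [← integral_exp_neg_sum_sq_add_sq_sum]
  refine tendsto_integral_filter_of_dominated_convergence
    (fun u : Fin m → ℝ => (∏ j, (p ^ ν j.castSucc * q)⁻¹ * (1 + 2 * (p * q) ^ 2 * u j ^ 2)⁻¹) *
      (p ^ ν (Fin.last m) * q)⁻¹) (Eventually.of_forall fun N => ?_) ?_ ?_ (ae_of_all _ fun u => ?_)
  · refine Continuous.aestronglyMeasurable ?_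
    exact (continuous_finsetProd _ fun j _ =>
      (continuous_rescaledFactor hp hq _ N).comp (continuous_apply j)).mul
        ((continuous_rescaledFactor hp hq _ N).comp (by fun_prop))
  · filter_upwards [eventually_ge_atTop 1] with N hN
    refine ae_of_all _ fun u => ?_
    have hprod := Finset.prod_nonneg fun (j : Fin m) (_ : j ∈ Finset.univ) =>
      rescaledFactor_nonneg hp hq (ν j.castSucc) N (u j)
    have hlast := rescaledFactor_nonneg hp hq (ν (Fin.last m)) N (-∑ j, u j)
    rw [Real.norm_of_nonneg (mul_nonneg hprod hlast)]
    refine mul_le_mul (Finset.prod_le_prod (fun j _ => rescaledFactor_nonneg hp hq _ N _)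
      fun j _ => rescaledFactor_le hp hq hpq _ N hN _) ?_ hlast
      (Finset.prod_nonneg fun j _ => by positivity)
    -- The decay of the last factor is discarded: the other `m` already give an integrable product.
    refine (rescaledFactor_le hp hq hpq _ N hN _).trans ?_
    refine mul_le_of_le_one_right (by positivity) (inv_le_one_of_one_le₀ ?_)
    exact le_add_of_nonneg_right (by positivity)
  · refine Integrable.mul_const ?_ _
    exact Integrable.fintype_prod (f := fun (j : Fin m) (x : ℝ) =>
      (p ^ ν j.castSucc * q)⁻¹ * (1 + 2 * (p * q) ^ 2 * x ^ 2)⁻¹)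
      fun j => (integrable_inv_one_add_mul_sq (by positivity)).const_mul _
  · have h := (tendsto_finsetProd Finset.univ fun (j : Fin m) _ =>
      tendsto_rescaledFactor hp hq hpq (ν j.castSucc) (u j)).mul
        (tendsto_rescaledFactor hp hq hpq (ν (Fin.last m)) (-∑ j, u j))
    rw [← Real.exp_sum, ← Real.exp_add, ← Finset.mul_sum, ← mul_add, neg_sq] at h
    exact h

/-! ### Exact factorisation at the saddle and comparison of constants. -/

theorem factorWeight_exp_add (ν N : ℕ) (a v p q : ℝ)
    (hp : p = Real.exp (2 * a) / (1 + Real.exp (2 * a))) (hq : q = 1 / (1 + Real.exp (2 * a))) :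
    factorWeight ν N (Real.exp (a + v)) =
      Real.exp (2 * a) ^ ν / (1 + Real.exp (2 * a)) ^ (ν + N + 1) *
        (saddleAmplitude p q ν v * (saddleProfile p q v ^ N)⁻¹) *
          Real.exp (-(2 * p * N) * v) := by
  have hs := Real.exp_pos (2 * a)
  have hp0 : 0 < p := by rw [hp]; positivity
  have hq0 : 0 < q := by rw [hq]; positivity
  have hpq : p + q = 1 := by rw [hp, hq]; field_simp; ring
  have hM := saddleProfile_pos hp0 hq0 v
  have hsq : Real.exp (a + v) ^ 2 = Real.exp (2 * a) * Real.exp (2 * v) := by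
    rw [← Real.exp_nat_mul, ← Real.exp_add]; congr 1; push_cast; ring
  have hD : 1 + Real.exp (2 * a) * Real.exp (2 * v) =
      (1 + Real.exp (2 * a)) * (q + p * Real.exp (2 * v)) := by
    rw [hp, hq]; field_simp
  have hE : (saddleProfile p q v ^ N)⁻¹ * Real.exp (-(2 * p * N) * v) =
      ((q + p * Real.exp (2 * v)) ^ N)⁻¹ := by
    rw [add_mul_exp_eq_exp_mul_saddleProfile hpq, mul_pow, mul_inv, ← Real.exp_nat_mul,
      ← Real.exp_neg, mul_comm]
    congr 2; ring
  rw [factorWeight, Complex.norm_real, Real.norm_of_nonneg (Real.exp_pos _).le, pow_mul, hsq, hD,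
    mul_assoc, mul_assoc, hE, saddleAmplitude, mul_pow, mul_pow,
    show ν + N + 1 = ν + 1 + N by ring, pow_add (q + p * Real.exp (2 * v)) (ν + 1) N]
  have hD0 : 0 < q + p * Real.exp (2 * v) := by positivity
  field_simp

theorem productWeight_eq_mul_integral_rescaledFactor {m : ℕ} (ν : Fin (m + 1) → ℕ) (N : ℕ)
    (hN : 1 ≤ N) (z : ℂ) (hz : z ≠ 0) (a p q : ℝ) (ha : Real.log ‖z‖ = (m + 1) * a)
    (hp : p = Real.exp (2 * a) / (1 + Real.exp (2 * a))) (hq : q = 1 / (1 + Real.exp (2 * a))) :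
    productWeight ν N z = ((2 * Real.pi) ^ m * ((√N)⁻¹ ^ m *
        (Real.exp (2 * a) ^ (∑ j, ν j) /
          (1 + Real.exp (2 * a)) ^ ((∑ j, ν j) + (m + 1) * (N + 1))))) *
      ∫ u : Fin m → ℝ, (∏ j, rescaledFactor p q (ν j.castSucc) N (u j)) *
        rescaledFactor p q (ν (Fin.last m)) N (-∑ j, u j) := by
  have hR : 0 < (√(N : ℝ))⁻¹ := inv_pos.2 (Real.sqrt_pos.2 (by exact_mod_cast hN))
  set R := (√(N : ℝ))⁻¹ with hRdef
  set F : (Fin m → ℝ) → ℝ := fun t => (∏ j, factorWeight (ν j.castSucc) N (Real.exp (t j))) *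
        factorWeight (ν (Fin.last m)) N (Real.exp (Real.log ‖z‖ - ∑ j, t j)) with hF
  have h1 : ∫ t, F t = R ^ m * ∫ u : Fin m → ℝ, F ((fun _ => a) + R • u) := by
    -- The substitution `t = a + R u` with `R = 1/√N`, of Jacobian `R^m`.
    rw [← integral_add_left_eq_self F (fun _ => a),
      Measure.integral_comp_smul volume (fun v => F ((fun _ => a) + v)) R, Module.finrank_fin_fun,
      abs_of_pos (by positivity), smul_eq_mul, mul_inv_cancel_left₀ (by positivity)]
  rw [productWeight_eq_integral_exp ν N z hz, h1, mul_assoc, mul_assoc, ← integral_const_mul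
    (Real.exp (2 * a) ^ (∑ j, ν j) / _)]
  congr 3
  funext u
  have hlast : Real.log ‖z‖ - ∑ j, ((fun _ => a : Fin m → ℝ) + R • u) j = a + R * -∑ j, u j := by
    simp only [Pi.add_apply, Pi.smul_apply, smul_eq_mul, Finset.sum_add_distrib, Finset.sum_const,
      Finset.card_univ, Fintype.card_fin, nsmul_eq_mul, ← Finset.mul_sum, ha]
    ring
  -- The linear exponents cancel because the `m + 1` deviations sum to zero.
  have hexp : (∏ j, Real.exp (-(2 * p * N) * (R * u j))) *
      Real.exp (-(2 * p * N) * (R * -∑ j, u j)) = 1 := by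
    rw [← Real.exp_sum, ← Real.exp_add, ← Finset.mul_sum, ← Finset.mul_sum, ← Real.exp_zero]
    congr 1; ring
  have hconst : (∏ j : Fin m, Real.exp (2 * a) ^ ν j.castSucc /
        (1 + Real.exp (2 * a)) ^ (ν j.castSucc + N + 1)) *
      (Real.exp (2 * a) ^ ν (Fin.last m) / (1 + Real.exp (2 * a)) ^ (ν (Fin.last m) + N + 1)) =
      Real.exp (2 * a) ^ (∑ j, ν j) /
          (1 + Real.exp (2 * a)) ^ ((∑ j, ν j) + (m + 1) * (N + 1)) := by
    rw [← Fin.prod_univ_castSucc (fun j => Real.exp (2 * a) ^ ν j /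
        (1 + Real.exp (2 * a)) ^ (ν j + N + 1)), Finset.prod_div_distrib, Finset.prod_pow_eq_pow_sum,
      Finset.prod_pow_eq_pow_sum]
    congr 2
    simp only [add_assoc, Finset.sum_add_distrib (f := ν), Finset.sum_const, Finset.card_univ,
      Fintype.card_fin, smul_eq_mul]
  simp only [hF]
  rw [hlast, factorWeight_exp_add _ _ _ _ p q hp hq]
  simp only [Pi.add_apply, Pi.smul_apply, smul_eq_mul, factorWeight_exp_add _ _ _ _ p q hp hq,
    Finset.prod_mul_distrib, rescaledFactor, ← hRdef]
  rw [← hconst]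
  linear_combination (∏ j : Fin m, Real.exp (2 * a) ^ ν j.castSucc /
        (1 + Real.exp (2 * a)) ^ (ν j.castSucc + N + 1)) *
      (Real.exp (2 * a) ^ ν (Fin.last m) / (1 + Real.exp (2 * a)) ^ (ν (Fin.last m) + N + 1)) *
      ((∏ j : Fin m, saddleAmplitude p q (ν j.castSucc) (R * u j)) *
        (∏ j : Fin m, (saddleProfile p q (R * u j) ^ N)⁻¹)) *
      (saddleAmplitude p q (ν (Fin.last m)) (R * -∑ j, u j) *
        (saddleProfile p q (R * -∑ j, u j) ^ N)⁻¹) * hexp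

/-- Since `pq = e^(2a) / (1 + e^(2a))²`, each of the `m` Gaussian factors contributes `(1 + e^(2a))
/ e^a`. This lowers the exponent `α + n(N + 1)` to `nN + α + 1` and yields `‖z‖^((1-n)/n)`. -/
theorem saddlePointWeight_eq (m α N : ℕ) (z : ℂ) (hz : z ≠ 0) (a p q : ℝ)
    (ha : Real.log ‖z‖ = (m + 1) * a)
    (hp : p = Real.exp (2 * a) / (1 + Real.exp (2 * a))) (hq : q = 1 / (1 + Real.exp (2 * a))) :
    saddlePointWeight (m + 1) α N z = ((2 * Real.pi) ^ m * ((√N)⁻¹ ^ m *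
        (Real.exp (2 * a) ^ α / (1 + Real.exp (2 * a)) ^ (α + (m + 1) * (N + 1))))) *
      (√(Real.pi / (2 * (p * q))) ^ m / √((m : ℝ) + 1)) := by
  have hz0 : 0 < ‖z‖ := norm_pos_iff.2 hz
  have hs := Real.exp_pos (2 * a)
  have hea := Real.exp_pos a
  have hsq : Real.exp (2 * a) = Real.exp a ^ 2 := by rw [← Real.exp_nat_mul]; norm_num
  have hm1 : (m : ℝ) + 1 ≠ 0 := by positivity
  have h2pi := Real.two_pi_pos
  have hsqrt : √(Real.pi / (2 * (p * q))) =
      √(2 * Real.pi) * (1 + Real.exp (2 * a)) / (2 * Real.exp a) := by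
    rw [Real.sqrt_eq_iff_mul_self_eq_of_pos (by positivity), hp, hq]
    have : √(2 * Real.pi) ^ 2 = 2 * Real.pi := Real.sq_sqrt h2pi.le
    field_simp
    rw [this, hsq]
  have hpi : (2 * Real.pi) ^ (3 / 2 * (((m + 1 : ℕ) : ℝ) - 1)) =
      (2 * Real.pi) ^ m * √(2 * Real.pi) ^ m := by
    rw [Nat.cast_add_one, add_sub_cancel_right, ← mul_pow, Real.rpow_mul h2pi.le, Real.rpow_natCast,
      Real.sqrt_eq_rpow]
    congr 1
    nth_rewrite 2 [← Real.rpow_one (2 * Real.pi)]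
    rw [← Real.rpow_add h2pi]; norm_num
  have h2 : (2 : ℝ) ^ (((m + 1 : ℕ) : ℝ) - 1) = 2 ^ m := by
    rw [Nat.cast_add_one, add_sub_cancel_right, Real.rpow_natCast]
  have hNp : (N : ℝ) ^ ((((m + 1 : ℕ) : ℝ) - 1) / 2) = √N ^ m := by
    rw [Nat.cast_add_one, add_sub_cancel_right, Real.sqrt_eq_rpow, ← Real.rpow_natCast,
      ← Real.rpow_mul (Nat.cast_nonneg N)]
    congr 1; ring
  have hzs : ‖z‖ ^ (2 / ((m + 1 : ℕ) : ℝ)) = Real.exp (2 * a) := by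
    rw [Real.rpow_def_of_pos hz0, ha, Nat.cast_add_one]; congr 1; field_simp
  have hzα : ‖z‖ ^ ((1 - ((m + 1 : ℕ) : ℝ) + 2 * (α : ℝ)) / ((m + 1 : ℕ) : ℝ)) =
      Real.exp (2 * a) ^ α / Real.exp a ^ m := by
    rw [Real.rpow_def_of_pos hz0, ha, Nat.cast_add_one, ← Real.exp_nat_mul, ← Real.exp_nat_mul,
      ← Real.exp_sub]
    congr 1; field_simp; ring
  rw [saddlePointWeight, hpi, h2, hNp, hzs, hzα, hsqrt, Nat.cast_add_one, div_pow, mul_pow, mul_pow,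
    show α + (m + 1) * (N + 1) = (m + 1) * N + α + 1 + m by ring,
    pow_add _ ((m + 1) * N + α + 1) m, inv_pow]
  field_simp
  rw [mul_pow]

theorem mainTheorem7 (m : ℕ) (ν : Fin (m + 1) → ℕ) (z : ℂ) (hz : z ≠ 0) :
    Asymptotics.IsEquivalent Filter.atTop
      (fun N : ℕ => productWeight ν N z)
      (fun N : ℕ => saddlePointWeight (m + 1) (∑ j, ν j) N z) := by
  obtain ⟨a, ha⟩ : ∃ a : ℝ, Real.log ‖z‖ = (m + 1) * a :=
    ⟨Real.log ‖z‖ / (m + 1), by field_simp⟩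
  obtain ⟨p, hp⟩ : ∃ p, p = Real.exp (2 * a) / (1 + Real.exp (2 * a)) := ⟨_, rfl⟩
  obtain ⟨q, hq⟩ : ∃ q, q = 1 / (1 + Real.exp (2 * a)) := ⟨_, rfl⟩
  have hp0 : 0 < p := by rw [hp]; positivity
  have hq0 : 0 < q := by rw [hq]; positivity
  have hpq : p + q = 1 := by rw [hp, hq]; field_simp; ring
  -- Convergence is equivalence here because the Gaussian limit is nonzero; the common prefactor is
  -- then multiplied back.
  have hlim := (Asymptotics.isEquivalent_const_iff_tendsto (by positivity)).2
    (tendsto_integral_prod_rescaledFactor hp0 hq0 hpq ν)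
  refine ((Asymptotics.IsEquivalent.refl (u := fun N : ℕ => (2 * Real.pi) ^ m * ((√(N : ℝ))⁻¹ ^ m *
        (Real.exp (2 * a) ^ (∑ j, ν j) / (1 + Real.exp (2 * a)) ^ ((∑ j, ν j) +
          (m + 1) * (N + 1)))))).mul hlim).congr_left ?_ |>.congr_right ?_
  · filter_upwards [eventually_ge_atTop 1] with N hN
    exact (productWeight_eq_mul_integral_rescaledFactor ν N hN z hz a p q ha hp hq).symm
  · filter_upwards with N
    exact (saddlePointWeight_eq m _ N z hz a p q ha hp hq).symm
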